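/- **Conventions.** All automata are deterministic, with finite state set, over a fixed alphabet $A$, have a start state from which every state is reachable, and this start state is not reachable from itself by a non-empty word. Morphisms are state maps preserving the start state and commuting with the next-state function; $\mathbf A\twoheadleftarrow\mathbf B$ means that there is a surjective morphism $\mathbf B\to\mathbf A$. States $p,q$ are $\mathcal R$-equivalent if each is reachable from the other; a morphism is $1{:}1\mathcal R$ if it is injective on every $\mathcal R$-class. For a word $w$, $[w]$ is its class in the syntactic monoid of the automaton (words modulo equal action on all states), and $\mathrm{rank}_{\mathbf B}(w)$ is the largest $r$ such that there are regular $\mathcal J$-classes $[w]^\omega<_{\mathcal J}J_1<_{\mathcal J}\dots<_{\mathcal J}J_r$ in the syntactic monoid of $\mathbf B$, where $[w]^\omega$ is the idempotent power of $[w]$. A morphism $\psi:\mathbf X\to\mathbf B$ satisfies the *rank condition* if for every state $q$ of $\mathbf X$ and all $\alpha,\beta\in A^+$: $q\alpha=q$, $(q)\psi\,\beta=(q)\psi$ and $\mathrm{rank}_{\mathbf B}(\alpha)\ge\mathrm{rank}_{\mathbf B}(\beta)$ imply $q\beta=q$. The *glc-cover* of $[\mathbf A,\mathbf C]=\{\mathbf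 X:\mathbf A\twoheadleftarrow\mathbf X\twoheadleftarrow\mathbf C\}$ is the join, for $\twoheadleftarrow$, of all $\mathbf X\in[\mathbf A,\mathbf C]$ having a $1{:}1\mathcal R$ morphism onto $\mathbf A$ with the rank condition. The stabilizer of a state $q$ is the monoid $\{[w]: qw=q\}$; an $\mathcal L$-order is unambiguous if the elements above any given element form a chain. For a morphism $\psi:\mathbf C\to\mathbf A$ and an edge $(q,a)$ of $\mathbf C$ with $q$, $qa$ in the same $\mathcal R$-class, put $\mathrm{rank}_{\mathbf A}(q,a)=\min\{\mathrm{rank}_{\mathbf A}(ax): x\in A^*,\ qax=q\}$; edges of $\mathbf A$ are ranked with $\psi=\mathrm{id}_{\mathbf A}$. **The construction GLC** for $\varphi:\mathbf C\to\mathbf A$. A congruence $\bmod\varphi_1$ on the states of $\mathbf C$ is built by induction on the path-length $d$ from the start state, beginning with the identity relation. In step $d$, consider every state $\bar q$ at path-length $d$, with current class $\{\bar q_1,\dots,\bar q_\ell\}$, and every $a\in A$ such that $\bar qa$ is at larger path-length. Let $r=(\bar qa)\varphi$. For an integer $n$ let $\mathrm{paths}(r,n)$ be the set of words $t$ such that $rt\equiv_{\mathcal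 R}r$ and all edges of the walk $(r,t)$ have rank $\le n$. Put $n_1=$ the maximum of the ranks of the edges inside the $\mathcal R$-classes of $\bar q_1a,\dots,\bar q_\ell a$ (with $\max\varnothing=-1$) and $\bar P_1=\{\bar q_jat: t\in\mathrm{paths}(r,n_1),\ 1\le j\le\ell\}$; inductively $n_{i+1}=$ the maximum of the ranks of the edges inside the $\mathcal R$-classes of elements of $\bar P_i$ and $\bar P_{i+1}=$ the union of the $\mathcal R$-classes of the states $\bar q_jat$, $t\in\mathrm{paths}(r,n_{i+1})$, $1\le j\le\ell$. Let $\bar P_\infty=\bigcup_i\bar P_i$. Any two elements of $\bar P_\infty$ with the same image under $\varphi$ are identified; the new relation is the congruence generated by the old one and all the identifications made in step $d$. $\bmod\varphi_1$ is the union of all the relations so obtained, $\mathbf C^{GLC}=\mathbf C/\bmod\varphi_1$, $\varphi_1$ is the quotient map, and $\varphi_2:\mathbf C^{GLC}\to\mathbf A$ is induced by $\varphi$. **Proposition.** Let $\mathbf A$ be the right Cayley graph (with a new identity element adjoined as start state, restricted to the vertices reachable from it) of a finite $A$-generated monoid $M_A$ whose $\mathcal R$-order is a tree, and let $\varphi:\mathbf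 A^{\mathsf{cov}}\to\mathbf A$ be a morphism such that all stabilizers of $\mathbf A^{\mathsf{cov}}$ are $\mathcal R$-trivial bands with unambiguous $\mathcal L$-order. (1) Then $\mathsf{glc}=\mathsf{GLC}$. That is, $\varphi=\varphi_1\varphi_2$; $\varphi_2$ is $1{:}1\mathcal R$ and satisfies the rank condition; $\varphi_2$ is the maximal such right factor of $\varphi$ (whenever $\varphi=\theta_1\theta_2$ with surjective morphisms $\theta_1$, $\theta_2$ and $\theta_2$ is $1{:}1\mathcal R$ and satisfies the rank condition, $\bmod\varphi_1$ refines $\bmod\theta_1$); and an automaton is a glc-cover of $[\mathbf A,\mathbf A^{\mathsf{cov}}]$ if and only if it is isomorphic to the automaton $\mathbf C^{GLC}$ constructed from $\mathbf C=\mathbf A^{\mathsf{cov}}$. (2) If moreover all stabilizers of $\mathbf A$ are $\mathcal R$-trivial bands with unambiguous $\mathcal L$-order, the same holds for the variant of the construction in which the rank of an edge $(\bar q,a)$ of $\mathbf A^{\mathsf{cov}}$ is replaced by the rank in $\mathbf A$ of its image edge $((\bar q)\varphi,a)$. -/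

import Mathlib

universe u v

/-! ### Green's relations and the algebraic rank in a monoid -/

namespace Green

/-- `x ≤_R y`: `x` is a right multiple of `y`. -/
def RLe {S : Type*} [Monoid S] (x y : S) : Prop := ∃ u : S, x = y * u

/-- `x ≤_L y`: `x` is a left multiple of `y`. -/
def LLe {S : Type*} [Monoid S] (x y : S) : Prop := ∃ u : S, x = u * y

/-- `x ≤_J y`: `x` is a two-sided multiple of `y`. -/
def JLe {S : Type*} [Monoid S] (x y : S) : Prop := ∃ u v : S, x = u * y * v

/-- `x <_J y`. -/
def JLt {S : Type*} [Monoid S] (x y : S) : Prop := JLe x y ∧ ¬ JLe y x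

/-- Von Neumann regular elements. -/
def IsRegularElt {S : Type*} [Monoid S] (x : S) : Prop := ∃ y : S, x * y * x = x

/-- The `R`-order of the monoid is a tree: the elements above any given element
form a chain (the class of the identity is the root). -/
def ROrderIsTree (S : Type*) [Monoid S] : Prop :=
  ∀ x y z : S, RLe x y → RLe x z → RLe y z ∨ RLe z y

/-- The `L`-order is unambiguous: the elements above any given element form a chain. -/
def LOrderUnambiguous (S : Type*) [Monoid S] : Prop :=
  ∀ x y z : S, LLe x y → LLe x z → LLe y z ∨ LLe z y

/-- Every element is idempotent. -/
def IsBand (S : Type*) [Monoid S] : Prop := ∀ x : S, IsIdempotentElem x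

/-- Every `R`-class of the monoid is a singleton. -/
def IsRTrivial (S : Type*) [Monoid S] : Prop :=
  ∀ x y : S, RLe x y → RLe y x → x = y

/-- The algebraic rank of `x`: the largest `r` for which there is a strict chain
`x^ω <_J J₁ <_J ⋯ <_J J_r` of regular `J`-classes, where `x^ω` is the idempotent among the
positive powers of `x`. A chain of `J`-classes is given by a list of representatives. -/
noncomputable def rank {S : Type*} [Monoid S] (x : S) : ℕ :=
  sSup {r : ℕ | ∃ e : S, IsIdempotentElem e ∧ (∃ n : ℕ, 0 < n ∧ e = x ^ n) ∧
    ∃ l : List S, l.length = r ∧ (∀ j ∈ l, IsRegularElt j) ∧ List.IsChain JLt (e :: l)}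

end Green

/-- A finite deterministic automaton over the alphabet `α`, with a start state from which all
states are reachable and to which one cannot return. -/
structure TrimAut (α : Type v) where
  /-- the state set -/
  Q : Type u
  /-- the start state -/
  start : Q
  /-- the next-state function -/
  step : Q → α → Q
  finite : Finite Q
  trim : ∀ q : Q, ∃ w : List α, w.foldl step start = q
  no_return : ∀ (q : Q) (a : α), step q a ≠ start

namespace TrimAut

variable {α : Type v}

/-- The state reached from `q` by reading `w`. -/
def run (A : TrimAut.{u} α) (q : A.Q) (w : List α) : A.Q := w.foldl A.step q

theorem run_append (A : TrimAut.{u} α) (q : A.Q) (w x : List α) :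
    A.run q (w ++ x) = A.run (A.run q w) x := by
  simp [run, List.foldl_append]

/-- Morphisms: state maps that preserve the start state and commute with the next-state
functions. -/
structure Hom (A B : TrimAut.{u} α) where
  /-- the state map -/
  toFun : A.Q → B.Q
  map_start : toFun A.start = B.start
  map_step : ∀ (q : A.Q) (a : α), toFun (A.step q a) = B.step (toFun q) a

instance (A B : TrimAut.{u} α) : CoeFun (Hom A B) (fun _ => A.Q → B.Q) := ⟨Hom.toFun⟩

/-- The identity morphism. -/
def Hom.id (A : TrimAut.{u} α) : Hom A A := ⟨fun q => q, rfl, fun _ _ => rfl⟩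

/-- Composition of morphisms (first `f`, then `g`). -/
def Hom.comp {A B C : TrimAut.{u} α} (g : Hom B C) (f : Hom A B) : Hom A C :=
  ⟨fun q => g (f q), by simp [f.map_start, g.map_start],
    fun q a => by simp [f.map_step, g.map_step]⟩

/-- Isomorphism of automata. -/
def Iso (A B : TrimAut.{u} α) : Prop := ∃ f : Hom A B, Function.Bijective f

/-- `A ≤ B` iff there is a surjective morphism from `B` onto `A`. -/
instance : Preorder (TrimAut.{u} α) where
  le A B := ∃ f : Hom B A, Function.Surjective f
  le_refl A := ⟨Hom.id A, fun q => ⟨q, rfl⟩⟩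
  le_trans _ _ _ := fun ⟨f, hf⟩ ⟨g, hg⟩ => ⟨f.comp g, hf.comp hg⟩

/-- Mutual reachability of two states. -/
def REquiv (A : TrimAut.{u} α) (p q : A.Q) : Prop :=
  (∃ w : List α, A.run q w = p) ∧ ∃ w : List α, A.run p w = q

/-- The length of a shortest directed path from the start state to `q`. -/
noncomputable def dist (A : TrimAut.{u} α) (q : A.Q) : ℕ :=
  sInf {n : ℕ | ∃ w : List α, w.length = n ∧ A.run A.start w = q}

/-- The syntactic congruence on words: two words are equivalent iff they act in the same way
on all states. -/
def synCon (A : TrimAut.{u} α) : Con (FreeMonoid α) where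
  r x y := ∀ q : A.Q, A.run q x.toList = A.run q y.toList
  iseqv := ⟨fun _ _ => rfl, fun h q => (h q).symm, fun h k q => (h q).trans (k q)⟩
  mul' := by
    intro w x y z h k q
    simp only [FreeMonoid.toList_mul, run_append]
    rw [h q, k]

/-- The syntactic monoid. -/
abbrev Syn (A : TrimAut.{u} α) : Type v := A.synCon.Quotient

/-- The class `[w]` of a word in the syntactic monoid. -/
def cls (A : TrimAut.{u} α) (w : List α) : A.Syn := ((FreeMonoid.ofList w : FreeMonoid α) : A.Syn)

/-- The rank of a word with respect to an automaton. -/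
noncomputable def wordRank (A : TrimAut.{u} α) (w : List α) : ℕ := Green.rank (A.cls w)

/-- The (right) stabilizer of a state, inside the syntactic monoid. -/
def stab (A : TrimAut.{u} α) (q : A.Q) : Submonoid A.Syn where
  carrier := {s | ∃ w : List α, A.run q w = q ∧ A.cls w = s}
  one_mem' := ⟨[], rfl, rfl⟩
  mul_mem' := by
    rintro _ _ ⟨w, hw, rfl⟩ ⟨x, hx, rfl⟩
    exact ⟨w ++ x, by rw [run_append, hw, hx], rfl⟩

/-- All stabilizers are `R`-trivial bands with unambiguous `L`-order. -/
def StabilizersGood (A : TrimAut.{u} α) : Prop :=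
  ∀ q : A.Q, Green.IsBand (A.stab q) ∧ Green.IsRTrivial (A.stab q) ∧
    Green.LOrderUnambiguous (A.stab q)

/-- A morphism is `1:1R` iff it is injective on every reachability class. -/
def OneOneR {A B : TrimAut.{u} α} (f : Hom A B) : Prop :=
  ∀ p q : A.Q, A.REquiv p q → f p = f q → p = q

/-- The rank condition for a morphism `f : A → B`. -/
def RankCondition {A B : TrimAut.{u} α} (f : Hom A B) : Prop :=
  ∀ (q : A.Q) (x y : List α), x ≠ [] → y ≠ [] →
    A.run q x = q → B.run (f q) y = f q → B.wordRank y ≤ B.wordRank x → A.run q y = q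

/-- `G` is the glc-cover of the interval `[A, C]`: the join, in the order of automata, of all
members `X` of the interval that have a surjective `1:1R` morphism onto `A` satisfying the rank
condition. -/
def IsGlc (A C G : TrimAut.{u} α) : Prop :=
  IsLUB {X : TrimAut.{u} α | X ∈ Set.Icc A C ∧
    ∃ f : Hom X A, Function.Surjective f ∧ OneOneR f ∧ RankCondition f} G

/-- `φ = φ₂ ∘ φ₁` where `φ₂` is `1:1R`, satisfies the rank condition, and is the maximal
right factor of `φ` with these two properties: for every other such factorization `θ₂ ∘ θ₁`,
the kernel of `φ₁` refines the kernel of `θ₁`. -/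
structure IsMaximalFactor {A G C : TrimAut.{u} α} (φ : Hom C A) (φ₁ : Hom C G) (φ₂ : Hom G A) :
    Prop where
  factor : ∀ q : C.Q, φ₂ (φ₁ q) = φ q
  surj₁ : Function.Surjective φ₁
  surj₂ : Function.Surjective φ₂
  oneOneR : OneOneR φ₂
  rankCondition : RankCondition φ₂
  maximal : ∀ (B : TrimAut.{u} α) (θ₁ : Hom C B) (θ₂ : Hom B A),
    Function.Surjective θ₁ → Function.Surjective θ₂ → (∀ q : C.Q, θ₂ (θ₁ q) = φ q) →
    OneOneR θ₂ → RankCondition θ₂ → ∀ p q : C.Q, φ₁ p = φ₁ q → θ₁ p = θ₁ q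

/-! ### Right Cayley graphs -/

/-- The right Cayley graph of the monoid `M` with generators `σ`, as an automaton: the vertices
are the elements of `M` with a new identity element added (`WithOne M`) that are reachable from
this new element, which is the start state, and the edges are `(s, a, s * σ a)`. -/
def cayley {M : Type u} [Monoid M] [Finite M] (σ : α → M) : TrimAut.{u} α where
  Q := {x : WithOne M // ∃ w : List α, w.foldl (fun y a => y * (σ a : WithOne M)) 1 = x}
  start := ⟨1, [], rfl⟩
  step x a := ⟨x.1 * (σ a : WithOne M), by
    obtain ⟨w, hw⟩ := x.2
    exact ⟨w ++ [a], by rw [List.foldl_append, hw]; rfl⟩⟩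
  finite := by
    have : Finite (WithOne M) := inferInstanceAs (Finite (Option M))
    infer_instance
  trim := by
    rintro ⟨x, w, rfl⟩
    refine ⟨w, ?_⟩
    induction w using List.reverseRecOn with
    | nil => rfl
    | append_singleton w a ih =>
      rw [List.foldl_append, ih]
      apply Subtype.ext
      simp [List.foldl_append]
  no_return := by
    rintro ⟨x, hx⟩ a h
    have h' : x * (σ a : WithOne M) = 1 := congrArg Subtype.val h
    clear h hx
    induction x with
    | one => rw [one_mul] at h'; exact WithOne.coe_ne_one h'
    | coe m => rw [← WithOne.coe_mul] at h'; exact WithOne.coe_ne_one h'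

/-! ### The bottom-up construction -/

/-- The rank, measured in `B` by means of `f : A → B`, of the edge `(q, a)` of `A`:
the minimum of the ranks in `B` of the words `a x` that label a closed walk at `q` in `A`.
It is used only for edges inside a reachability class, where such walks exist. -/
noncomputable def edgeRank {A B : TrimAut.{u} α} (_f : Hom A B) (q : A.Q) (a : α) : ℕ :=
  sInf {n : ℕ | ∃ x : List α, A.run q (a :: x) = q ∧ n = B.wordRank (a :: x)}

/-- The rank, in `B` itself, of the image under `f` of the edge `(q, a)` of `A`. -/
noncomputable def imageEdgeRank {A B : TrimAut.{u} α} (f : Hom A B) (q : A.Q) (a : α) : ℕ :=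
  edgeRank (Hom.id B) (f q) a

/-- The labels of the walks that start at `r`, stay in the reachability class of `r`, and
whose edges all have rank at most `j`. -/
def paths (A : TrimAut.{u} α) (r : A.Q) (j : ℤ) : Set (List α) :=
  {w | A.REquiv (A.run r w) r ∧ ∀ (x : List α) (a : α) (y : List α), w = x ++ a :: y →
    (edgeRank (Hom.id A) (A.run r x) a : ℤ) ≤ j}

section Construction

variable {A C : TrimAut.{u} α} (φ : Hom C A) (rk : C.Q → α → ℕ)

/-- The largest rank (for the given ranking `rk` of the edges of `C`) of an edge inside the
reachability class of an element of `T`, and `-1` if there is no such edge. -/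
noncomputable def maxRank (rk : C.Q → α → ℕ) (T : Set C.Q) : ℤ :=
  sSup (insert (-1) {n : ℤ | ∃ p₀ ∈ T, ∃ (p : C.Q) (b : α),
    C.REquiv p p₀ ∧ C.REquiv (C.step p b) p ∧ n = rk p b})

/-- The sets `P₁ ⊆ P₂ ⊆ ⋯` (numbered from `0`) built from a class `K` of states of `C`, the
representative `q ∈ K` and the letter `a`. -/
noncomputable def stageP (K : Set C.Q) (q : C.Q) (a : α) : ℕ → Set C.Q
  | 0 => {p | ∃ k ∈ K, ∃ t ∈ A.paths (φ (C.step q a))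
      (maxRank rk {p' | ∃ k' ∈ K, p' = C.step k' a}), p = C.run (C.step k a) t}
  | i + 1 => {p | ∃ k ∈ K, ∃ t ∈ A.paths (φ (C.step q a)) (maxRank rk (stageP K q a i)),
      C.REquiv p (C.run (C.step k a) t)}

/-- `P_∞`. -/
def limitP (K : Set C.Q) (q : C.Q) (a : α) : Set C.Q := ⋃ i : ℕ, stageP φ rk K q a i

/-- The automaton congruence (equivalence relation stable under the next-state function)
generated by a relation. -/
inductive CongGen (C : TrimAut.{u} α) (r : C.Q → C.Q → Prop) : C.Q → C.Q → Prop
  | of {x y : C.Q} : r x y → CongGen C r x y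
  | refl (x : C.Q) : CongGen C r x x
  | symm {x y : C.Q} : CongGen C r x y → CongGen C r y x
  | trans {x y z : C.Q} : CongGen C r x y → CongGen C r y z → CongGen C r x z
  | step {x y : C.Q} (a : α) : CongGen C r x y → CongGen C r (C.step x a) (C.step y a)

/-- The congruence after stage `d` of the induction on the path-length from the start state.
At stage `0` no states are identified. At stage `d + 1` one takes all states `q` at path-length
`d`, with the class `K` of `q` constructed so far, and all letters `a` for which `q · a` is at
a larger path-length; any two elements of the resulting set `P_∞` with the same image under `φ`
are identified. -/
def glcStage : ℕ → C.Q → C.Q → Prop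
  | 0 => fun x y => x = y
  | d + 1 => CongGen C (fun x y => glcStage d x y ∨
      ∃ (q : C.Q) (a : α), C.dist q = d ∧ C.dist q < C.dist (C.step q a) ∧
        x ∈ limitP φ rk {k | glcStage d q k} q a ∧
        y ∈ limitP φ rk {k | glcStage d q k} q a ∧ φ x = φ y)

theorem glcStage_refl (d : ℕ) (x : C.Q) : glcStage φ rk d x x := by
  cases d with
  | zero => rfl
  | succ d => exact CongGen.refl x

theorem glcStage_symm {d : ℕ} {x y : C.Q} (h : glcStage φ rk d x y) : glcStage φ rk d y x := by
  cases d with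
  | zero => exact Eq.symm h
  | succ d => exact CongGen.symm h

theorem glcStage_trans {d : ℕ} {x y z : C.Q} (h : glcStage φ rk d x y)
    (k : glcStage φ rk d y z) : glcStage φ rk d x z := by
  cases d with
  | zero => exact Eq.trans h k
  | succ d => exact CongGen.trans h k

theorem glcStage_step {d : ℕ} {x y : C.Q} (a : α) (h : glcStage φ rk d x y) :
    glcStage φ rk d (C.step x a) (C.step y a) := by
  cases d with
  | zero => exact congrArg (fun z => C.step z a) h
  | succ d => exact CongGen.step a h

theorem glcStage_mono {d e : ℕ} (hde : d ≤ e) {x y : C.Q} (h : glcStage φ rk d x y) :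
    glcStage φ rk e x y := by
  induction hde with
  | refl => exact h
  | step _ ih => exact CongGen.of (Or.inl ih)

theorem glcStage_map {d : ℕ} {x y : C.Q} (h : glcStage φ rk d x y) : φ x = φ y := by
  induction d generalizing x y with
  | zero => exact congrArg φ h
  | succ d ih =>
    change CongGen C _ x y at h
    induction h with
    | of h =>
      rcases h with h | ⟨_, _, _, _, _, _, h⟩
      · exact ih h
      · exact h
    | refl => rfl
    | symm _ ih' => exact ih'.symm
    | trans _ _ ih₁ ih₂ => exact ih₁.trans ih₂
    | step a _ ih' => rw [φ.map_step, φ.map_step, ih']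

/-- The kernel of `φ₁`: the union of the congruences constructed at all stages. -/
def glcSetoid : Setoid C.Q where
  r x y := ∃ d : ℕ, glcStage φ rk d x y
  iseqv :=
    ⟨fun x => ⟨0, glcStage_refl φ rk 0 x⟩, fun ⟨d, h⟩ => ⟨d, glcStage_symm φ rk h⟩,
      fun ⟨d, h⟩ ⟨e, k⟩ => ⟨max d e, glcStage_trans φ rk
        (glcStage_mono φ rk (le_max_left d e) h) (glcStage_mono φ rk (le_max_right d e) k)⟩⟩

/-- The automaton resulting from the bottom-up construction: the quotient of `C` by the
constructed congruence. -/
def GLC : TrimAut.{u} α where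
  Q := Quotient (glcSetoid φ rk)
  start := Quotient.mk _ C.start
  step x a := Quotient.map (fun q => C.step q a)
    (fun x y (h : ∃ d : ℕ, glcStage φ rk d x y) =>
      h.elim fun d h => ⟨d, glcStage_step φ rk a h⟩) x
  finite := by
    have := C.finite
    infer_instance
  trim := by
    intro x
    induction x using Quotient.inductionOn with
    | h q =>
      obtain ⟨w, rfl⟩ := C.trim q
      refine ⟨w, ?_⟩
      induction w using List.reverseRecOn with
      | nil => rfl
      | append_singleton w a ih => simp only [List.foldl_append, ih]; rfl
  no_return := by
    intro x a
    induction x using Quotient.inductionOn with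
    | h q =>
      intro h
      obtain ⟨d, hd⟩ : (glcSetoid φ rk).r (C.step q a) C.start := Quotient.exact h
      have := glcStage_map φ rk hd
      rw [φ.map_step, φ.map_start] at this
      exact A.no_return _ _ this

/-- `φ₁`: a state is mapped to its class. -/
def glcFst : Hom C (GLC φ rk) where
  toFun := Quotient.mk (glcSetoid φ rk)
  map_start := rfl
  map_step _ _ := rfl

/-- `φ₂`: a class is mapped to the common image of its elements under `φ`. -/
def glcSnd : Hom (GLC φ rk) A where
  toFun := Quotient.lift φ.toFun (fun x y (h : ∃ d : ℕ, glcStage φ rk d x y) =>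
    h.elim fun _ h => glcStage_map φ rk h)
  map_start := φ.map_start
  map_step x a := by
    induction x using Quotient.inductionOn with
    | h q => exact φ.map_step q a

end Construction

end TrimAut

/-!
In an automaton with good stabilizers the classes of any two loops at a state satisfy `x y = x` or
`y x = y`, so composing loops does not raise the rank above the maximum, and the rank of a loop is
the largest rank of its edges. Consequently the numbers `n₁, n₂, …` of the construction are ranks
of loops of `C`.

Maximality: let `C → B → A` be a factorization whose second factor satisfies the rank condition.
At a state of `B` lying on a loop of rank at least `n`, the rank condition lifts every walk of `A`
of rank at most `n` to a walk inside the reachability class. Hence every set `P_∞` is mapped into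
one reachability class of `B`, where the `1:1R` property forces the identifications made.

Conversely, a power of any loop of the quotient lifts to a loop of `C`, say at `p`. The state `p`
is not the start state, so it is entered from a state closer to it, and the set `P₁` formed there
contains all states reached from `p` along walks whose rank is at most that of the loop. Two such
states with the same image in `A` are identified; this yields both the `1:1R` property and the
rank condition.
-/

namespace Green

variable {S : Type*} [Monoid S]

theorem JLe.refl (x : S) : JLe x x := ⟨1, 1, by simp⟩

theorem JLe.trans {x y z : S} (hxy : JLe x y) (hyz : JLe y z) : JLe x z := by
  obtain ⟨a, b, rfl⟩ := hxy
  obtain ⟨c, d, rfl⟩ := hyz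
  exact ⟨a * c, d * b, by simp only [mul_assoc]⟩

theorem JLe.trans_jLt {x y z : S} (hxy : JLe x y) (hyz : JLt y z) : JLt x z :=
  ⟨hxy.trans hyz.1, fun hzx => hyz.2 (hzx.trans hxy)⟩

theorem JLe.pow_self (x : S) {n : ℕ} (hn : n ≠ 0) : JLe (x ^ n) x :=
  ⟨1, x ^ (n - 1), by rw [one_mul, mul_pow_sub_one hn]⟩

theorem exists_isIdempotentElem_pow [Finite S] (x : S) :
    ∃ n : ℕ, n ≠ 0 ∧ IsIdempotentElem (x ^ n) := by
  let _ : TopologicalSpace S := ⊥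
  have : DiscreteTopology S := ⟨rfl⟩
  obtain ⟨_, ⟨n, hn, rfl⟩, hx⟩ := exists_idempotent_in_compact_subsemigroup
    (fun _ : S => continuous_of_discreteTopology) {y | ∃ n : ℕ, n ≠ 0 ∧ x ^ n = y}
    ⟨x, 1, one_ne_zero, pow_one x⟩ (Set.toFinite _).isCompact
    (by
      rintro _ ⟨m, hm, rfl⟩ _ ⟨n, -, rfl⟩
      exact ⟨m + n, by omega, pow_add x m n⟩)
  exact ⟨n, hn, hx⟩

theorem length_le_card_of_isChain_jLt [Finite S] {l : List S} (hl : l.IsChain JLt) :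
    l.length ≤ Nat.card S := by
  have := Fintype.ofFinite S
  have : IsTrans S JLt := ⟨fun _ _ _ hxy hyz => hxy.1.trans_jLt hyz⟩
  have : l.Nodup := (List.isChain_iff_pairwise.mp hl).imp fun {x y} hxy hne => by
    subst hne
    exact hxy.2 (JLe.refl x)
  rw [Nat.card_eq_fintype_card]
  exact this.length_le_card

theorem card_mem_upperBounds_rank [Finite S] (x : S) :
    Nat.card S ∈ upperBounds {r : ℕ | ∃ e : S, IsIdempotentElem e ∧
      (∃ n : ℕ, 0 < n ∧ e = x ^ n) ∧ ∃ l : List S, l.length = r ∧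
        (∀ j ∈ l, IsRegularElt j) ∧ List.IsChain JLt (e :: l)} := by
  rintro _ ⟨e, -, -, l, rfl, -, hl⟩
  exact (Nat.le_succ _).trans (length_le_card_of_isChain_jLt hl)

theorem rank_le_card [Finite S] (x : S) : rank x ≤ Nat.card S :=
  csSup_le' (card_mem_upperBounds_rank x)

theorem rank_one : rank (1 : S) = 0 := by
  refine Nat.le_zero.mp (csSup_le' ?_)
  rintro _ ⟨_, -, ⟨n, -, rfl⟩, _ | ⟨y, l⟩, rfl, -, hl⟩
  · exact le_rfl
  · rw [one_pow] at hl
    exact absurd ⟨y, 1, by simp⟩ hl.rel.2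

theorem rank_pow (x : S) {n : ℕ} (hn : n ≠ 0) : rank (x ^ n) = rank x := by
  have idempotent_pow_iff (e : S) : (IsIdempotentElem e ∧ ∃ m, 0 < m ∧ e = (x ^ n) ^ m) ↔
      IsIdempotentElem e ∧ ∃ m, 0 < m ∧ e = x ^ m := by
    refine and_congr_right fun he => ⟨?_, ?_⟩
    · rintro ⟨m, hm, rfl⟩
      exact ⟨n * m, Nat.mul_pos (Nat.pos_of_ne_zero hn) hm, (pow_mul x n m).symm⟩
    · rintro ⟨m, hm, rfl⟩
      exact ⟨m, hm, by rw [← pow_mul, mul_comm, pow_mul, he.pow_eq hn]⟩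
  simp only [rank, ← and_assoc, idempotent_pow_iff]

theorem rank_le_rank_of_jLe [Finite S] {e x : S} (he : IsIdempotentElem e) (hx : JLe x e) :
    rank e ≤ rank x := by
  refine csSup_le' ?_
  rintro _ ⟨_, -, ⟨m, hm, rfl⟩, l, rfl, hreg, hl⟩
  rw [he.pow_eq hm.ne'] at hl
  obtain ⟨n, hn, hidem⟩ := exists_isIdempotentElem_pow x
  refine le_csSup ⟨_, card_mem_upperBounds_rank x⟩
    ⟨x ^ n, hidem, ⟨n, Nat.pos_of_ne_zero hn, rfl⟩, l, rfl, hreg, ?_⟩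
  cases l with
  | nil => exact List.isChain_singleton _
  | cons y l =>
    rw [List.isChain_cons_cons] at hl ⊢
    exact ⟨((JLe.pow_self x hn).trans hx).trans_jLt hl.1, hl.2⟩

theorem rank_mul_le_rank_mul_swap [Finite S] (x y : S) : rank (x * y) ≤ rank (y * x) := by
  obtain ⟨n, hn, hidem⟩ := exists_isIdempotentElem_pow (x * y)
  rw [← rank_pow (x * y) hn, ← rank_pow (y * x) n.succ_ne_zero]
  exact rank_le_rank_of_jLe hidem ⟨y, x, by rw [pow_succ, ← mul_assoc, mul_pow_mul]⟩

theorem rank_mul_comm [Finite S] (x y : S) : rank (x * y) = rank (y * x) :=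
  (rank_mul_le_rank_mul_swap x y).antisymm (rank_mul_le_rank_mul_swap y x)

theorem mul_eq_left_or_mul_eq_left (hB : IsBand S) (hR : IsRTrivial S) (hL : LOrderUnambiguous S)
    (x y : S) : x * y = x ∨ y * x = y := by
  have hxyx : x * y = x * y * x :=
    hR _ _ ⟨y, by rw [mul_assoc (x * y) x y, (hB (x * y)).eq]⟩ ⟨x, rfl⟩
  rcases hL (x * y) x y ⟨x * y, hxyx⟩ ⟨x, rfl⟩ with ⟨u, rfl⟩ | ⟨u, rfl⟩
  · exact Or.inl (by rw [mul_assoc, (hB y).eq])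
  · exact Or.inr (by rw [mul_assoc, (hB x).eq])

end Green

namespace TrimAut

variable {α : Type v} {A B C : TrimAut.{u} α}

theorem run_cons (q : A.Q) (a : α) (w : List α) : A.run q (a :: w) = A.run (A.step q a) w := rfl

theorem run_concat (q : A.Q) (w : List α) (a : α) :
    A.run q (w ++ [a]) = A.step (A.run q w) a :=
  run_append A q w [a]

theorem Hom.map_run (f : Hom A B) (q : A.Q) (w : List α) : f (A.run q w) = B.run (f q) w := by
  induction w generalizing q with
  | nil => rfl
  | cons a w ih => rw [run_cons, run_cons, ih, f.map_step]

theorem Hom.apply_eq_apply (f g : Hom A B) (q : A.Q) : f q = g q := by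
  obtain ⟨w, rfl⟩ : ∃ w, A.run A.start w = q := A.trim q
  rw [f.map_run, g.map_run, f.map_start, g.map_start]

theorem Hom.surjective (f : Hom A B) : Function.Surjective f := by
  intro q
  obtain ⟨w, rfl⟩ : ∃ w, B.run B.start w = q := B.trim q
  exact ⟨A.run A.start w, by rw [f.map_run, f.map_start]⟩

theorem REquiv.refl (q : A.Q) : A.REquiv q q := ⟨⟨[], rfl⟩, ⟨[], rfl⟩⟩

theorem REquiv.symm {p q : A.Q} (h : A.REquiv p q) : A.REquiv q p := ⟨h.2, h.1⟩

theorem REquiv.trans {p q r : A.Q} (hpq : A.REquiv p q) (hqr : A.REquiv q r) : A.REquiv p r := by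
  obtain ⟨⟨x, rfl⟩, ⟨y, hy⟩⟩ := hpq
  obtain ⟨⟨z, rfl⟩, ⟨t, ht⟩⟩ := hqr
  exact ⟨⟨z ++ x, run_append _ _ _ _⟩, ⟨y ++ t, by rw [run_append, hy, ht]⟩⟩

theorem REquiv.map (f : Hom A B) {p q : A.Q} (h : A.REquiv p q) : B.REquiv (f p) (f q) := by
  obtain ⟨⟨x, hx⟩, ⟨y, hy⟩⟩ := h
  exact ⟨⟨x, by rw [← f.map_run, hx]⟩, ⟨y, by rw [← f.map_run, hy]⟩⟩

theorem rEquiv_run_of_run_append_eq {q : A.Q} {x y : List α} (h : A.run q (x ++ y) = q) :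
    A.REquiv (A.run q x) q :=
  ⟨⟨x, rfl⟩, y, by rw [← run_append, h]⟩

theorem run_append_comm_eq {q : A.Q} {x y : List α} (h : A.run q (x ++ y) = q) :
    A.run (A.run q x) (y ++ x) = A.run q x := by
  rw [run_append, ← run_append A q, h]

theorem exists_step_eq_dist_lt {p : A.Q} (hp : p ≠ A.start) :
    ∃ (q : A.Q) (a : α), A.step q a = p ∧ A.dist q < A.dist p := by
  obtain ⟨w₀, hw₀⟩ : ∃ w, A.run A.start w = p := A.trim p
  obtain ⟨w, hlen, rfl⟩ : ∃ w : List α, w.length = A.dist p ∧ A.run A.start w = p :=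
    Nat.sInf_mem (s := {n : ℕ | ∃ w : List α, w.length = n ∧ A.run A.start w = p})
      ⟨_, w₀, rfl, hw₀⟩
  rcases w.eq_nil_or_concat' with rfl | ⟨v, a, rfl⟩
  · exact absurd rfl hp
  · refine ⟨A.run A.start v, a, (run_concat _ v a).symm, ?_⟩
    calc A.dist (A.run A.start v) ≤ v.length := Nat.sInf_le ⟨v, rfl, rfl⟩
      _ < (v ++ [a]).length := by simp
      _ = _ := hlen

theorem cls_append (A : TrimAut.{u} α) (x y : List α) : A.cls (x ++ y) = A.cls x * A.cls y := rfl

theorem cls_eq_iff {x y : List α} : A.cls x = A.cls y ↔ ∀ q, A.run q x = A.run q y := Con.eq _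

theorem cls_flatten_replicate (A : TrimAut.{u} α) (n : ℕ) (w : List α) :
    A.cls (List.replicate n w).flatten = A.cls w ^ n := by
  induction n with
  | zero => rfl
  | succ n ih => rw [List.replicate_succ, List.flatten_cons, cls_append, ih, pow_succ']

theorem Hom.cls_eq (f : Hom A B) {x y : List α} (h : A.cls x = A.cls y) : B.cls x = B.cls y := by
  refine cls_eq_iff.mpr fun q => ?_
  obtain ⟨p, rfl⟩ := f.surjective q
  rw [← f.map_run, ← f.map_run, cls_eq_iff.mp h]

instance finite_syn (A : TrimAut.{u} α) : Finite A.Syn := by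
  have := A.finite
  refine Finite.of_injective (Quotient.lift (fun (w : FreeMonoid α) (q : A.Q) => A.run q w.toList)
    fun _ _ h => funext h) ?_
  rintro ⟨x⟩ ⟨y⟩ h
  exact Quotient.sound (congrFun h)

theorem wordRank_le_card (A : TrimAut.{u} α) (w : List α) : A.wordRank w ≤ Nat.card A.Syn :=
  Green.rank_le_card _

theorem wordRank_nil (A : TrimAut.{u} α) : A.wordRank [] = 0 := Green.rank_one

theorem wordRank_append_comm (A : TrimAut.{u} α) (x y : List α) :
    A.wordRank (x ++ y) = A.wordRank (y ++ x) :=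
  Green.rank_mul_comm (A.cls x) (A.cls y)

theorem wordRank_flatten_replicate (A : TrimAut.{u} α) {n : ℕ} (hn : n ≠ 0) (w : List α) :
    A.wordRank (List.replicate n w).flatten = A.wordRank w := by
  rw [wordRank, cls_flatten_replicate, Green.rank_pow _ hn, wordRank]

/-! ### Loops -/

/-- `w` is the label of a nonempty closed walk at `q`. The rank condition compares such words, and
the reachability classes containing an edge are those whose states have a loop. -/
structure IsLoop (A : TrimAut.{u} α) (q : A.Q) (w : List α) : Prop where
  ne_nil : w ≠ []
  run_eq : A.run q w = q

theorem IsLoop.map (f : Hom A B) {q : A.Q} {w : List α} (hw : A.IsLoop q w) :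
    B.IsLoop (f q) w :=
  ⟨hw.ne_nil, by rw [← f.map_run, hw.run_eq]⟩

theorem IsLoop.ne_start {q : A.Q} {w : List α} (hw : A.IsLoop q w) : q ≠ A.start := by
  obtain ⟨v, a, rfl⟩ := w.eq_nil_or_concat'.resolve_left hw.ne_nil
  rw [← hw.run_eq, run_concat]
  exact A.no_return _ a

theorem IsLoop.flatten_replicate {q : A.Q} {w : List α} (hw : A.IsLoop q w) {n : ℕ}
    (hn : n ≠ 0) : A.IsLoop q (List.replicate n w).flatten := by
  refine ⟨by simp [hn, hw.ne_nil], ?_⟩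
  clear hn
  induction n with
  | zero => rfl
  | succ n ih => rw [List.replicate_succ, List.flatten_cons, run_append, hw.run_eq, ih]

theorem IsLoop.exists_le_wordRank_of_rEquiv (B : TrimAut.{u} α) {p q : A.Q} {w : List α}
    (hw : A.IsLoop p w) (hpq : A.REquiv p q) :
    ∃ z, A.IsLoop q z ∧ B.wordRank w ≤ B.wordRank z := by
  obtain ⟨⟨s, hs⟩, ⟨t, ht⟩⟩ := hpq
  obtain ⟨n, hn, hidem⟩ := Green.exists_isIdempotentElem_pow (B.cls w)
  have hpow := hw.flatten_replicate hn
  refine ⟨s ++ (List.replicate n w).flatten ++ t, ⟨by simp [hpow.ne_nil], ?_⟩, ?_⟩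
  · rw [run_append, run_append, hs, hpow.run_eq, ht]
  · rw [wordRank, ← Green.rank_pow _ hn]
    exact Green.rank_le_rank_of_jLe hidem
      ⟨B.cls s, B.cls t, by rw [cls_append, cls_append, cls_flatten_replicate]⟩

theorem IsLoop.exists_lift (B : TrimAut.{u} α) (f : Hom C A) {q : A.Q} {w : List α}
    (hw : A.IsLoop q w) :
    ∃ p z, f p = q ∧ C.IsLoop p z ∧ B.wordRank z = B.wordRank w := by
  obtain ⟨p, rfl⟩ := f.surjective q
  obtain ⟨n, hn, hidem⟩ := Green.exists_isIdempotentElem_pow (C.cls w)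
  have hpow := hw.flatten_replicate hn
  refine ⟨C.run p (List.replicate n w).flatten, _, ?_, ⟨hpow.ne_nil, ?_⟩,
    B.wordRank_flatten_replicate hn w⟩
  · rw [f.map_run, hpow.run_eq]
  · rw [← run_append]
    refine cls_eq_iff.mp ?_ p
    rw [cls_append, cls_flatten_replicate, hidem.eq]

/-! ### Ranks of edges and walks -/

theorem edgeRank_run_le (f : Hom A B) {q : A.Q} {x y : List α} {a : α}
    (h : A.run q (x ++ a :: y) = q) : edgeRank f (A.run q x) a ≤ B.wordRank (x ++ a :: y) := by
  rw [wordRank_append_comm]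
  exact Nat.sInf_le ⟨y ++ x, run_append_comm_eq h, rfl⟩

theorem exists_wordRank_eq_edgeRank (f : Hom A B) {q : A.Q} {a : α}
    (h : A.REquiv (A.step q a) q) :
    ∃ x, A.run q (a :: x) = q ∧ B.wordRank (a :: x) = edgeRank f q a := by
  obtain ⟨y, hy⟩ := h.2
  obtain ⟨x, hx, hrank⟩ := Nat.sInf_mem
    (s := {n : ℕ | ∃ x : List α, A.run q (a :: x) = q ∧ n = B.wordRank (a :: x)}) ⟨_, y, hy, rfl⟩
  exact ⟨x, hx, hrank.symm⟩

theorem nil_mem_paths (r : A.Q) (j : ℤ) : [] ∈ A.paths r j :=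
  ⟨REquiv.refl r, fun x a y h => by simp at h⟩

theorem mem_paths_of_run_append_eq {r : A.Q} {w z : List α} {j : ℤ} (h : A.run r (w ++ z) = r)
    (hj : (A.wordRank (w ++ z) : ℤ) ≤ j) : w ∈ A.paths r j := by
  refine ⟨rEquiv_run_of_run_append_eq h, ?_⟩
  rintro x a y rfl
  rw [List.append_assoc, List.cons_append] at h hj
  exact (Nat.cast_le.mpr (edgeRank_run_le (Hom.id A) h)).trans hj

theorem paths_mono (r : A.Q) {i j : ℤ} (hij : i ≤ j) : A.paths r i ⊆ A.paths r j :=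
  fun _ hw => ⟨hw.1, fun x a y h => (hw.2 x a y h).trans hij⟩

theorem rEquiv_step_of_cons_mem_paths {r : A.Q} {a : α} {w : List α} {j : ℤ}
    (h : a :: w ∈ A.paths r j) : A.REquiv (A.step r a) r := by
  obtain ⟨z, hz⟩ := h.1.2
  rw [← run_append] at hz
  exact rEquiv_run_of_run_append_eq (x := [a]) (y := w ++ z) hz

theorem mem_paths_step_of_cons_mem_paths {r : A.Q} {a : α} {w : List α} {j : ℤ}
    (h : a :: w ∈ A.paths r j) : w ∈ A.paths (A.step r a) j :=
  ⟨h.1.trans (rEquiv_step_of_cons_mem_paths h).symm,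
    fun x b y hw => h.2 (a :: x) b y (by rw [hw, List.cons_append])⟩

/-! ### Good stabilizers -/

theorem StabilizersGood.cls_append_eq_or (hA : A.StabilizersGood) {q : A.Q} {x y : List α}
    (hx : A.run q x = q) (hy : A.run q y = q) :
    A.cls (x ++ y) = A.cls x ∨ A.cls (y ++ x) = A.cls y := by
  obtain ⟨hB, hR, hL⟩ := hA q
  let s : A.stab q := ⟨A.cls x, x, hx, rfl⟩
  let t : A.stab q := ⟨A.cls y, y, hy, rfl⟩
  exact (Green.mul_eq_left_or_mul_eq_left hB hR hL s t).imp
    (congrArg Subtype.val) (congrArg Subtype.val)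

theorem StabilizersGood.wordRank_append_le_max (hA : A.StabilizersGood) (f : Hom A B) {q : A.Q}
    {x y : List α} (hx : A.run q x = q) (hy : A.run q y = q) :
    B.wordRank (x ++ y) ≤ max (B.wordRank x) (B.wordRank y) := by
  rcases hA.cls_append_eq_or hx hy with h | h
  · exact le_max_of_le_left (congrArg Green.rank (f.cls_eq h)).le
  · rw [wordRank_append_comm]
    exact le_max_of_le_right (congrArg Green.rank (f.cls_eq h)).le

theorem StabilizersGood.wordRank_le_wordRank_append (hA : A.StabilizersGood) (f : Hom A B)
    {q : A.Q} {x : List α} (hx : A.run q x = q) (y : List α) :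
    B.wordRank x ≤ B.wordRank (x ++ y) := by
  have hidem : A.cls (x ++ x) = A.cls x :=
    congrArg Subtype.val ((hA q).1 ⟨A.cls x, x, hx, rfl⟩)
  exact Green.rank_le_rank_of_jLe (f.cls_eq hidem)
    ⟨1, B.cls y, by rw [one_mul, cls_append]⟩

/-- The closing word is found from the end of the walk: if `v` closes the rest of the walk after
its first letter `a` and `y` closes `a`, then `v ++ y` closes the walk. -/
theorem StabilizersGood.exists_wordRank_append_le (hA : A.StabilizersGood) (f : Hom A B) {n : ℕ}
    {q : A.Q} {w : List α} (hw : A.REquiv (A.run q w) q)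
    (hn : ∀ x a y, w = x ++ a :: y → edgeRank f (A.run q x) a ≤ n) :
    ∃ z, A.run q (w ++ z) = q ∧ B.wordRank (w ++ z) ≤ n := by
  induction w generalizing q with
  | nil => exact ⟨[], rfl, by simp [wordRank_nil]⟩
  | cons a w ih =>
    have hqa : A.REquiv (A.step q a) q := by
      obtain ⟨z, hz⟩ := hw.2
      exact ⟨⟨[a], rfl⟩, w ++ z, by rw [run_append]; exact hz⟩
    obtain ⟨v, hv, hvn⟩ := ih (hw.trans hqa.symm) fun x b y h => hn (a :: x) b y (by rw [h]; rfl)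
    obtain ⟨y, hy, hya⟩ := exists_wordRank_eq_edgeRank f hqa
    have hrot : B.wordRank (a :: w ++ (v ++ y)) = B.wordRank (w ++ v ++ (y ++ [a])) := by
      simpa using B.wordRank_append_comm [a] (w ++ v ++ y)
    refine ⟨v ++ y, ?_, ?_⟩
    · rw [List.cons_append, run_cons, ← List.append_assoc, run_append, hv]
      exact hy
    · calc B.wordRank (a :: w ++ (v ++ y))
          ≤ max (B.wordRank (w ++ v)) (B.wordRank (y ++ [a])) :=
            hrot ▸ hA.wordRank_append_le_max f hv (run_append_comm_eq (x := [a]) hy)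
        _ ≤ n := max_le hvn (by
            rw [B.wordRank_append_comm y [a]]
            exact hya.trans_le (hn [] a w rfl))

/-- `rk` ranks the edges of `C` compatibly with the ranks of words in `A`: the rank of every loop
is the largest rank of its edges. Both rankings of the theorem have this property. -/
def IsLoopRanking (A : TrimAut.{u} α) {C : TrimAut.{u} α} (rk : C.Q → α → ℕ) : Prop :=
  ∀ (q : C.Q) (w : List α), C.IsLoop q w →
    IsGreatest {n | ∃ x a y, w = x ++ a :: y ∧ n = rk (C.run q x) a} (A.wordRank w)

theorem StabilizersGood.isLoopRanking_edgeRank (hC : C.StabilizersGood) (φ : Hom C A) :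
    IsLoopRanking A (edgeRank φ) := by
  intro q w hw
  have edge_le : ∀ x a y, w = x ++ a :: y → edgeRank φ (C.run q x) a ≤ A.wordRank w := by
    rintro x a y rfl
    exact edgeRank_run_le φ hw.run_eq
  refine ⟨?_, by rintro _ ⟨x, a, y, h, rfl⟩; exact edge_le x a y h⟩
  by_contra hmem
  have edge_lt : ∀ x a y, w = x ++ a :: y → edgeRank φ (C.run q x) a < A.wordRank w :=
    fun x a y h => (edge_le x a y h).lt_of_ne fun heq => hmem ⟨x, a, y, h, heq.symm⟩
  have hpos : 0 < A.wordRank w := by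
    obtain ⟨a, y, rfl⟩ := List.exists_cons_of_ne_nil hw.ne_nil
    exact Nat.zero_lt_of_lt (edge_lt [] a y rfl)
  obtain ⟨z, -, hz⟩ := hC.exists_wordRank_append_le φ (hw.run_eq.symm ▸ REquiv.refl q)
    fun x a y h => Nat.le_sub_one_of_lt (edge_lt x a y h)
  have := hC.wordRank_le_wordRank_append φ hw.run_eq z
  omega

theorem StabilizersGood.isLoopRanking_imageEdgeRank (hA : A.StabilizersGood) (φ : Hom C A) :
    IsLoopRanking A (imageEdgeRank φ) := by
  intro q w hw
  simpa only [imageEdgeRank, φ.map_run] using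
    hA.isLoopRanking_edgeRank (Hom.id A) (φ q) w (hw.map φ)

section Factorization

variable {rk : C.Q → α → ℕ}

theorem IsLoopRanking.exists_isLoop_le_wordRank (h : IsLoopRanking A rk) {p : C.Q} {a : α}
    (hp : C.REquiv (C.step p a) p) : ∃ w, C.IsLoop p w ∧ rk p a ≤ A.wordRank w := by
  obtain ⟨x, hx⟩ := hp.2
  have hloop : C.IsLoop p (a :: x) := ⟨List.cons_ne_nil a x, hx⟩
  exact ⟨a :: x, hloop, (h p _ hloop).2 ⟨[], a, x, rfl, rfl⟩⟩

theorem IsLoopRanking.bddAbove_maxRank (h : IsLoopRanking A rk) (T : Set C.Q) :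
    BddAbove (insert (-1) {n : ℤ | ∃ p₀ ∈ T, ∃ (p : C.Q) (b : α),
      C.REquiv p p₀ ∧ C.REquiv (C.step p b) p ∧ n = rk p b}) := by
  refine bddAbove_insert.mpr ⟨Nat.card A.Syn, ?_⟩
  rintro _ ⟨_, -, p, b, -, hb, rfl⟩
  obtain ⟨w, -, hw⟩ := h.exists_isLoop_le_wordRank hb
  exact Nat.cast_le.mpr (hw.trans (A.wordRank_le_card w))

theorem IsLoopRanking.natCast_le_maxRank_iff (h : IsLoopRanking A rk) {T : Set C.Q} {n : ℕ} :
    (n : ℤ) ≤ maxRank rk T ↔ ∃ p ∈ T, ∃ w, C.IsLoop p w ∧ n ≤ A.wordRank w := by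
  constructor
  · intro hn
    rcases Int.csSup_mem (Set.insert_nonempty _ _) (h.bddAbove_maxRank T) with
      hmax | ⟨p₀, hp₀, p, b, hp, hb, hmax⟩
    · exact absurd (hn.trans_eq hmax) (by omega)
    · obtain ⟨w, hw, hrk⟩ := h.exists_isLoop_le_wordRank hb
      obtain ⟨z, hz, hwz⟩ := hw.exists_le_wordRank_of_rEquiv A hp
      exact ⟨p₀, hp₀, z, hz, (Nat.cast_le.mp (hn.trans_eq hmax)).trans (hrk.trans hwz)⟩
  · rintro ⟨p, hp, w, hw, hn⟩
    obtain ⟨x, b, y, rfl, hrk⟩ := (h p w hw).1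
    refine le_csSup_of_le (h.bddAbove_maxRank T) (Or.inr ⟨p, hp, C.run p x, b,
      rEquiv_run_of_run_append_eq hw.run_eq, ?_, rfl⟩) (Nat.cast_le.mpr (hrk ▸ hn))
    exact rEquiv_run_of_run_append_eq (x := [b]) (y := y ++ x) (run_append_comm_eq hw.run_eq)

/-! ### Maximality -/

/-- `[]` is the only walk of negative rank, hence `j` may be negative and loops are only required
for natural numbers below `j`. -/
theorem RankCondition.rEquiv_run_of_mem_paths {θ : Hom B A} (hθ : RankCondition θ) {j : ℤ}
    {c : B.Q} (hc : ∀ n : ℕ, (n : ℤ) ≤ j → ∃ x, B.IsLoop c x ∧ n ≤ A.wordRank x) {w : List α}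
    (hw : w ∈ A.paths (θ c) j) : B.REquiv (B.run c w) c := by
  induction w generalizing c with
  | nil => exact REquiv.refl c
  | cons a w ih =>
    obtain ⟨y, hy, hrank⟩ :=
      exists_wordRank_eq_edgeRank (Hom.id A) (rEquiv_step_of_cons_mem_paths hw)
    obtain ⟨x, hx, hyx⟩ := hc _ (hw.2 [] a w rfl)
    have hcy : B.run c (a :: y) = c :=
      hθ c x (a :: y) hx.ne_nil (List.cons_ne_nil a y) hx.run_eq hy (hrank.trans_le hyx)
    have hca : B.REquiv (B.step c a) c := rEquiv_run_of_run_append_eq (x := [a]) hcy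
    refine (ih (fun n hn => ?_) ?_).trans hca
    · obtain ⟨z, hz, hnz⟩ := hc n hn
      obtain ⟨z', hz', hzz'⟩ := hz.exists_le_wordRank_of_rEquiv A hca.symm
      exact ⟨z', hz', hnz.trans hzz'⟩
    · rw [θ.map_step]
      exact mem_paths_step_of_cons_mem_paths hw

theorem IsLoopRanking.rEquiv_run_of_mem_paths (h : IsLoopRanking A rk) {θ₁ : Hom C B}
    {θ₂ : Hom B A} (hθ : RankCondition θ₂) {c : B.Q} {T : Set C.Q}
    (hT : ∀ p ∈ T, B.REquiv (θ₁ p) c) {w : List α} (hw : w ∈ A.paths (θ₂ c) (maxRank rk T)) :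
    B.REquiv (B.run c w) c := by
  refine hθ.rEquiv_run_of_mem_paths (fun n hn => ?_) hw
  obtain ⟨p, hp, x, hx, hnx⟩ := h.natCast_le_maxRank_iff.mp hn
  obtain ⟨z, hz, hxz⟩ := (hx.map θ₁).exists_le_wordRank_of_rEquiv A (hT p hp)
  exact ⟨z, hz, hnx.trans hxz⟩

variable {φ : Hom C A}

theorem IsLoopRanking.rEquiv_of_mem_limitP (h : IsLoopRanking A rk) {θ₁ : Hom C B} {θ₂ : Hom B A}
    (hθ : RankCondition θ₂) {K : Set C.Q} {q : C.Q} (hK : ∀ k ∈ K, θ₁ k = θ₁ q) {a : α}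
    {p : C.Q} (hp : p ∈ limitP φ rk K q a) : B.REquiv (θ₁ p) (B.step (θ₁ q) a) := by
  have step_eq {k : C.Q} (hk : k ∈ K) : θ₁ (C.step k a) = B.step (θ₁ q) a := by
    rw [θ₁.map_step, hK k hk]
  have image_eq : φ (C.step q a) = θ₂ (B.step (θ₁ q) a) := by
    rw [← θ₁.map_step]
    exact φ.apply_eq_apply (θ₂.comp θ₁) _
  obtain ⟨i, hi⟩ := Set.mem_iUnion.mp hp
  clear hp
  induction i generalizing p with
  | zero =>
    obtain ⟨k, hk, t, ht, rfl⟩ := hi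
    rw [θ₁.map_run, step_eq hk]
    refine h.rEquiv_run_of_mem_paths (θ₁ := θ₁) hθ ?_ (image_eq ▸ ht)
    rintro _ ⟨k', hk', rfl⟩
    exact step_eq hk' ▸ REquiv.refl _
  | succ i ih =>
    obtain ⟨k, hk, t, ht, hpt⟩ := hi
    refine (hpt.map θ₁).trans ?_
    rw [θ₁.map_run, step_eq hk]
    exact h.rEquiv_run_of_mem_paths hθ (fun p => ih) (image_eq ▸ ht)

theorem CongGen.map_eq (f : Hom C B) {r : C.Q → C.Q → Prop} (hr : ∀ x y, r x y → f x = f y)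
    {x y : C.Q} (hxy : CongGen C r x y) : f x = f y := by
  induction hxy with
  | of h => exact hr _ _ h
  | refl => rfl
  | symm _ ih => exact ih.symm
  | trans _ _ ih₁ ih₂ => exact ih₁.trans ih₂
  | step a _ ih => rw [f.map_step, f.map_step, ih]

theorem IsLoopRanking.map_eq_of_glcStage (h : IsLoopRanking A rk) {θ₁ : Hom C B} {θ₂ : Hom B A}
    (hone : OneOneR θ₂) (hθ : RankCondition θ₂) {d : ℕ} {x y : C.Q}
    (hxy : glcStage φ rk d x y) : θ₁ x = θ₁ y := by
  induction d generalizing x y with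
  | zero => exact congrArg θ₁ hxy
  | succ d ih =>
    refine CongGen.map_eq θ₁ ?_ hxy
    rintro x y (hxy | ⟨q, a, -, -, hx, hy, he⟩)
    · exact ih hxy
    · have hK : ∀ k ∈ {k | glcStage φ rk d q k}, θ₁ k = θ₁ q := fun k hk => (ih hk).symm
      refine hone _ _ ((h.rEquiv_of_mem_limitP hθ hK hx).trans
        (h.rEquiv_of_mem_limitP hθ hK hy).symm) ?_
      calc θ₂ (θ₁ x) = φ x := (θ₂.comp θ₁).apply_eq_apply φ x
        _ = φ y := he
        _ = θ₂ (θ₁ y) := φ.apply_eq_apply (θ₂.comp θ₁) y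

/-! ### The quotient satisfies the two conditions -/

theorem IsLoopRanking.glcFst_run_eq (h : IsLoopRanking A rk) {p : C.Q} {z : List α}
    (hz : C.IsLoop p z) {w w' : List α} (hw : w ∈ A.paths (φ p) (A.wordRank z))
    (hw' : w' ∈ A.paths (φ p) (A.wordRank z)) (he : φ (C.run p w) = φ (C.run p w')) :
    glcFst φ rk (C.run p w) = glcFst φ rk (C.run p w') := by
  obtain ⟨q, a, rfl, hlt⟩ := exists_step_eq_dist_lt hz.ne_start
  have hqq : glcStage φ rk (C.dist q) q q := glcStage_refl φ rk _ q
  have wordRank_le : (A.wordRank z : ℤ) ≤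
      maxRank rk {p | ∃ k ∈ {k | glcStage φ rk (C.dist q) q k}, p = C.step k a} :=
    h.natCast_le_maxRank_iff.mpr ⟨C.step q a, ⟨q, hqq, rfl⟩, z, hz, le_rfl⟩
  have run_mem {v : List α} (hv : v ∈ A.paths (φ (C.step q a)) (A.wordRank z)) :
      C.run (C.step q a) v ∈ limitP φ rk {k | glcStage φ rk (C.dist q) q k} q a :=
    Set.mem_iUnion.mpr ⟨0, q, hqq, v, paths_mono _ wordRank_le hv, rfl⟩
  exact Quotient.sound ⟨C.dist q + 1,
    CongGen.of (Or.inr ⟨q, a, rfl, hlt, run_mem hw, run_mem hw', he⟩)⟩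

theorem IsLoopRanking.run_eq_run (h : IsLoopRanking A rk) {c : (GLC φ rk).Q} {z : List α}
    (hz : (GLC φ rk).IsLoop c z) {w w' : List α}
    (hw : w ∈ A.paths (glcSnd φ rk c) (A.wordRank z))
    (hw' : w' ∈ A.paths (glcSnd φ rk c) (A.wordRank z))
    (he : A.run (glcSnd φ rk c) w = A.run (glcSnd φ rk c) w') :
    (GLC φ rk).run c w = (GLC φ rk).run c w' := by
  obtain ⟨p, z', rfl, hz', hrank⟩ := hz.exists_lift A (glcFst φ rk)
  rw [← hrank] at hw hw'
  rw [← Hom.map_run, ← Hom.map_run]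
  refine h.glcFst_run_eq hz' hw hw' ?_
  rw [φ.map_run, φ.map_run]
  exact he

theorem IsLoopRanking.oneOneR_glcSnd (h : IsLoopRanking A rk) : OneOneR (glcSnd φ rk) := by
  rintro c _ ⟨⟨t, ht⟩, ⟨s, rfl⟩⟩ he
  rw [← run_append] at ht
  by_cases hst : s ++ t = []
  · rw [(List.append_eq_nil_iff.mp hst).1]
    rfl
  have hloop : (GLC φ rk).IsLoop c (s ++ t) := ⟨hst, ht⟩
  rw [Hom.map_run] at he
  exact h.run_eq_run hloop (nil_mem_paths _ _)
    (mem_paths_of_run_append_eq (hloop.map (glcSnd φ rk)).run_eq le_rfl) he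

theorem IsLoopRanking.rankCondition_glcSnd (h : IsLoopRanking A rk) :
    RankCondition (glcSnd φ rk) := by
  intro c x y hx _ hcx hcy hrank
  refine h.run_eq_run ⟨hx, hcx⟩ (mem_paths_of_run_append_eq (z := []) ?_ ?_)
    (nil_mem_paths _ _) hcy
  · rwa [List.append_nil]
  · rwa [List.append_nil, Nat.cast_le]

theorem IsLoopRanking.isMaximalFactor (h : IsLoopRanking A rk) :
    IsMaximalFactor φ (glcFst φ rk) (glcSnd φ rk) where
  factor _ := rfl
  surj₁ := Hom.surjective _
  surj₂ := Hom.surjective _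
  oneOneR := h.oneOneR_glcSnd
  rankCondition := h.rankCondition_glcSnd
  maximal B θ₁ θ₂ _ _ _ hone hθ p q hpq := by
    obtain ⟨d, hd⟩ := Quotient.exact hpq
    exact h.map_eq_of_glcStage hone hθ hd

end Factorization

/-! ### The glc-cover -/

theorem le_of_forall_eq_imp_eq {f : Hom C A} {g : Hom C B}
    (h : ∀ p q, f p = f q → g p = g q) : B ≤ A := by
  choose s hs using f.surjective
  refine ⟨⟨fun x => g (s x), ?_, fun x a => ?_⟩, Hom.surjective _⟩
  · rw [← g.map_start]
    exact h _ _ (by rw [hs, f.map_start])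
  · rw [← g.map_step]
    exact h _ _ (by rw [hs, f.map_step, hs])

theorem iso_iff_antisymmRel : Iso A B ↔ AntisymmRel (· ≤ ·) A B := by
  constructor
  · rintro ⟨f, hf⟩
    exact ⟨le_of_forall_eq_imp_eq (f := f) (g := Hom.id A) fun p q he => hf.1 he, f, hf.2⟩
  · rintro ⟨⟨g, -⟩, f, hf⟩
    have left_inv : Function.LeftInverse g f := (g.comp f).apply_eq_apply (Hom.id A)
    exact ⟨f, left_inv.injective, hf⟩

theorem IsMaximalFactor.isGlc {G : TrimAut.{u} α} {φ : Hom C A} {φ₁ : Hom C G} {φ₂ : Hom G A}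
    (h : IsMaximalFactor φ φ₁ φ₂) : IsGlc A C G := by
  refine IsGreatest.isLUB
    ⟨⟨⟨⟨φ₂, h.surj₂⟩, φ₁, h.surj₁⟩, φ₂, h.surj₂, h.oneOneR, h.rankCondition⟩, ?_⟩
  rintro X ⟨⟨-, θ₁, hθ₁⟩, θ₂, hθ₂, hone, hrank⟩
  exact le_of_forall_eq_imp_eq
    (h.maximal X θ₁ θ₂ hθ₁ hθ₂ ((θ₂.comp θ₁).apply_eq_apply φ) hone hrank)

theorem IsMaximalFactor.isGlc_iff_iso {G : TrimAut.{u} α} {φ : Hom C A} {φ₁ : Hom C G}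
    {φ₂ : Hom G A} (h : IsMaximalFactor φ φ₁ φ₂) (H : TrimAut.{u} α) :
    IsGlc A C H ↔ Iso H G := by
  rw [iso_iff_antisymmRel]
  exact ⟨fun hH => ⟨hH.2 h.isGlc.1, h.isGlc.2 hH.1⟩,
    fun hHG => (isLUB_congr_of_antisymmRel hHG).mpr h.isGlc⟩

end TrimAut

theorem mainTheorem2_general {α : Type v} {A C : TrimAut.{u} α} (φ : TrimAut.Hom C A) :
    (C.StabilizersGood →
      TrimAut.IsMaximalFactor φ (TrimAut.glcFst φ (TrimAut.edgeRank φ))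
        (TrimAut.glcSnd φ (TrimAut.edgeRank φ)) ∧
      ∀ G : TrimAut.{u} α, TrimAut.IsGlc A C G ↔
        TrimAut.Iso G (TrimAut.GLC φ (TrimAut.edgeRank φ))) ∧
    (A.StabilizersGood →
      TrimAut.IsMaximalFactor φ (TrimAut.glcFst φ (TrimAut.imageEdgeRank φ))
        (TrimAut.glcSnd φ (TrimAut.imageEdgeRank φ)) ∧
      ∀ G : TrimAut.{u} α, TrimAut.IsGlc A C G ↔
        TrimAut.Iso G (TrimAut.GLC φ (TrimAut.imageEdgeRank φ))) := by
  refine ⟨fun hC => ?_, fun hA => ?_⟩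
  · have hmax := (hC.isLoopRanking_edgeRank φ).isMaximalFactor (φ := φ)
    exact ⟨hmax, hmax.isGlc_iff_iso⟩
  · have hmax := (hA.isLoopRanking_imageEdgeRank φ).isMaximalFactor (φ := φ)
    exact ⟨hmax, hmax.isGlc_iff_iso⟩

theorem mainTheorem2 {α : Type v} {M : Type u} [Monoid M] [Finite M]
    (σ : α → M) (hσ : Submonoid.closure (Set.range σ) = ⊤)
    (hM : Green.ROrderIsTree M)
    (C : TrimAut.{u} α) (φ : TrimAut.Hom C (TrimAut.cayley σ))
    (hC : C.StabilizersGood) :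
    (TrimAut.IsMaximalFactor φ (TrimAut.glcFst φ (TrimAut.edgeRank φ))
        (TrimAut.glcSnd φ (TrimAut.edgeRank φ)) ∧
      ∀ G : TrimAut.{u} α, TrimAut.IsGlc (TrimAut.cayley σ) C G ↔
        TrimAut.Iso G (TrimAut.GLC φ (TrimAut.edgeRank φ))) ∧
    ((TrimAut.cayley σ).StabilizersGood →
      TrimAut.IsMaximalFactor φ (TrimAut.glcFst φ (TrimAut.imageEdgeRank φ))
        (TrimAut.glcSnd φ (TrimAut.imageEdgeRank φ)) ∧
      ∀ G : TrimAut.{u} α, TrimAut.IsGlc (TrimAut.cayley σ) C G ↔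
        TrimAut.Iso G (TrimAut.GLC φ (TrimAut.imageEdgeRank φ))) :=
  (mainTheorem2_general φ).imp_left fun h => h hC
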